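/- Let $D\subset\mathbb R^d$ be a bounded open set and let $\kappa$ be a measurable function on $D$ with $0<\kappa_0\le\kappa\le\kappa_1<\infty$ (for instance, a domain with smooth boundary and $\kappa$ smooth up to the boundary). Let $H=L^2(D)$ (real valued) with norm $\|\cdot\|$, let $V=H^1_0(D)$, and let $A$ be the realisation in $H$ of $u\mapsto-\nabla\cdot(\kappa\nabla u)$ with homogeneous Dirichlet boundary condition: $u\in D(A)$ and $Au=f$ if and only if $u\in V$, $f\in H$ and $\int_D\kappa\nabla u\cdot\nabla v=\int_D fv$ for all $v\in V$ (when $\partial D$ and $\kappa$ are smooth, $D(A)=H^2(D)\cap H^1_0(D)$). Let $(e_j)_{j\ge1}$ be an orthonormal basis of $H$ with $Ae_j=\lambda_je_j$, where $0<\lambda_1\le\lambda_2\le\cdots$ and $\lambda_j\to\infty$. For $s\ge0$ let $$\|x\|_s=\Big(\sum_{j}\lambda_j^s\langle x,e_j\rangle^2\Big)^{1/2},\qquad \dot H^s=\{x\in H:\|x\|_s<\infty\}.$$ For $k>0$ let $$R_{k/2}=(I+\tfrac k2A)^{-1},\qquad M_k=I+\tfrac k4A,\qquad \mathcal A_k=AM_kR_{k/2}^2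 .$$ Let $(E(t))_{t\ge0}$ and $(E_k(t))_{t\ge0}$ be the strongly continuous (in fact analytic) semigroups on $H$ generated by $-A$ and $-\mathcal A_k$, respectively. Then there is an absolute constant $C>0$ (in particular, independent of $k$, $t$, $r$, $s$, $x$, $D$ and $\kappa$) such that, for all $k>0$, all $0\le r\le s\le2$ and all $t>0$, the operator $R_{k/2}$ is defined on all of $\dot H^{s-r}$ and $$\|(E(t)-E_k(t)R_{k/2})x\|\le C\,k^{s/2}\,t^{-r/2}\,\|x\|_{s-r}\qquad\text{for all }x\in\dot H^{s-r},$$ $$\|(E(t)-E_k(t))x\|\le C\,k^{s/2}\,\|x\|_{s}\qquad\text{for all }x\in\dot H^{s}.$$ -/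

import Mathlib

open MeasureTheory Filter Topology
open scoped ContDiff

noncomputable section

namespace EllipticSemigroup

/-! ### The elliptic operator -/

/-- The data of the operator `-∇·(κ∇)` with homogeneous Dirichlet condition: a bounded open set
`D ⊆ ℝᵈ` and a measurable coefficient `κ` with `0 < κ₀ ≤ κ ≤ κ₁` on `D`. -/
structure DirichletData (d : ℕ) where
  D : Set (EuclideanSpace ℝ (Fin d))
  isOpen : IsOpen D
  isBounded : Bornology.IsBounded D
  κ : EuclideanSpace ℝ (Fin d) → ℝ
  measurable_coeff : AEStronglyMeasurable κ (volume.restrict D)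
  coercive : ∃ κ₀ : ℝ, 0 < κ₀ ∧ ∀ x ∈ D, κ₀ ≤ κ x
  bounded : ∃ κ₁ : ℝ, ∀ x ∈ D, κ x ≤ κ₁

/-- The real Hilbert space `L²(D)`. -/
abbrev L2 {d : ℕ} (D : Set (EuclideanSpace ℝ (Fin d))) : Type :=
  Lp ℝ 2 (volume.restrict D)

/-- Test functions, `φ ∈ C_c^∞(D)`. -/
structure IsTest {d : ℕ} (D : Set (EuclideanSpace ℝ (Fin d)))
    (φ : EuclideanSpace ℝ (Fin d) → ℝ) : Prop where
  contDiff : ContDiff ℝ ∞ φ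
  hasCompactSupport : HasCompactSupport φ
  tsupport_subset : tsupport φ ⊆ D

/-- The partial derivative `∂ᵢφ`. -/
def partialDeriv {d : ℕ} (i : Fin d) (φ : EuclideanSpace ℝ (Fin d) → ℝ)
    (x : EuclideanSpace ℝ (Fin d)) : ℝ :=
  fderiv ℝ φ x (EuclideanSpace.single i 1)

/-- The set of pairs `(φ, ∇φ)`, `φ ∈ C_c^∞(D)`, as a subspace of `L²(D) × L²(D)ᵈ`. -/
def testPairs {d : ℕ} (D : Set (EuclideanSpace ℝ (Fin d))) :
    Submodule ℝ (L2 D × (Fin d → L2 D)) where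
  carrier := {p | ∃ φ, IsTest D φ ∧ (p.1 =ᵐ[volume.restrict D] φ) ∧
    ∀ i, p.2 i =ᵐ[volume.restrict D] partialDeriv i φ}
  zero_mem' := by
    refine ⟨0, ⟨contDiff_const, HasCompactSupport.zero, ?_⟩, Lp.coeFn_zero _ _ _, fun i => ?_⟩
    · simp [tsupport]
    · refine (Lp.coeFn_zero _ _ _).trans (Eventually.of_forall fun x => ?_)
      have h : fderiv ℝ (0 : EuclideanSpace ℝ (Fin d) → ℝ) x = 0 := by
        rw [fderiv_zero]; rfl
      simp [partialDeriv, h]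
  add_mem' := by
    rintro p q ⟨φ, hφ, hp, hp'⟩ ⟨ψ, hψ, hq, hq'⟩
    refine ⟨φ + ψ, ⟨hφ.contDiff.add hψ.contDiff,
      hφ.hasCompactSupport.add hψ.hasCompactSupport,
      (tsupport_add φ ψ).trans (Set.union_subset hφ.tsupport_subset hψ.tsupport_subset)⟩,
      (Lp.coeFn_add _ _).trans (hp.add hq), fun i => ?_⟩
    refine (Lp.coeFn_add _ _).trans (((hp' i).add (hq' i)).trans
      (Eventually.of_forall fun x => ?_))
    have h1 := hφ.contDiff.differentiable (by simp) x
    have h2 := hψ.contDiff.differentiable (by simp) x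
    simp [partialDeriv, fderiv_add h1 h2]
  smul_mem' := by
    rintro c p ⟨φ, hφ, hp, hp'⟩
    refine ⟨c • φ, ⟨hφ.contDiff.const_smul c, hφ.hasCompactSupport.smul_left (f := fun _ => c),
      (tsupport_smul_subset_right (fun _ => c) φ).trans hφ.tsupport_subset⟩,
      (Lp.coeFn_smul _ _).trans (hp.const_smul c), fun i => ?_⟩
    refine (Lp.coeFn_smul _ _).trans (((hp' i).const_smul c).trans
      (Eventually.of_forall fun x => ?_))
    have h1 := hφ.contDiff.differentiable (by simp) x
    simp [partialDeriv, fderiv_const_smul h1 c]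

/-- The Sobolev space `H¹₀(D)`, the closure of `C_c^∞(D)` in the `H¹`-norm. An element is recorded
as the pair `(u, ∇u)` of the function and its weak gradient. -/
def H10 {d : ℕ} (D : Set (EuclideanSpace ℝ (Fin d))) :
    Submodule ℝ (L2 D × (Fin d → L2 D)) :=
  (testPairs D).topologicalClosure

namespace DirichletData

variable {d : ℕ} (P : DirichletData d)

/-- The bilinear form `a(u,v) = ∫_D κ ∇u·∇v`, as a function of the two gradients. -/
def form (g h : Fin d → L2 P.D) : ℝ :=
  ∑ i, ∫ x in P.D, P.κ x * (g i x * h i x)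

theorem integrable_form (g h : L2 P.D) :
    Integrable (fun x => P.κ x * (g x * h x)) (volume.restrict P.D) := by
  obtain ⟨κ₀, h0, hκ₀⟩ := P.coercive
  obtain ⟨κ₁, hκ₁⟩ := P.bounded
  have hgh : Integrable (fun x => g x * h x) (volume.restrict P.D) :=
    MemLp.integrable_mul (Lp.memLp g) (Lp.memLp h)
  refine hgh.bdd_mul (c := κ₁) P.measurable_coeff ?_
  filter_upwards [ae_restrict_mem P.isOpen.measurableSet] with x hx
  rw [Real.norm_eq_abs, abs_of_nonneg (h0.le.trans (hκ₀ x hx))]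
  exact hκ₁ x hx

theorem form_add (g g' h : Fin d → L2 P.D) :
    P.form (g + g') h = P.form g h + P.form g' h := by
  unfold form
  rw [← Finset.sum_add_distrib]
  refine Finset.sum_congr rfl fun i _ => ?_
  rw [← integral_add (P.integrable_form _ _) (P.integrable_form _ _)]
  refine integral_congr_ae ?_
  filter_upwards [Lp.coeFn_add (g i) (g' i)] with x hx
  rw [Pi.add_apply, hx, Pi.add_apply]; ring

theorem form_smul (c : ℝ) (g h : Fin d → L2 P.D) :
    P.form (c • g) h = c * P.form g h := by
  unfold form
  rw [Finset.mul_sum]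
  refine Finset.sum_congr rfl fun i _ => ?_
  rw [← integral_const_mul]
  refine integral_congr_ae ?_
  filter_upwards [Lp.coeFn_smul c (g i)] with x hx
  rw [Pi.smul_apply, hx, Pi.smul_apply, smul_eq_mul]; ring

/-- The graph of the realisation in `L²(D)` of `A : H¹₀(D) → H¹₀(D)'`, `Au = -∇·(κ∇u)`:
the pairs `(u, f)` with `u ∈ H¹₀(D)`, `f ∈ L²(D)` and `a(u,v) = ⟨f,v⟩` for all `v ∈ H¹₀(D)`. -/
def opGraph : Submodule ℝ (L2 P.D × L2 P.D) where
  carrier := {p | ∃ g, (p.1, g) ∈ H10 P.D ∧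
    ∀ v h, (v, h) ∈ H10 P.D → P.form g h = inner ℝ p.2 v}
  zero_mem' := by
    refine ⟨0, (H10 P.D).zero_mem, fun v h _ => ?_⟩
    have := P.form_smul 0 0 h
    simpa using this
  add_mem' := by
    rintro p q ⟨g, hg, hp⟩ ⟨g', hg', hq⟩
    refine ⟨g + g', (H10 P.D).add_mem hg hg', fun v h hv => ?_⟩
    rw [form_add, hp v h hv, hq v h hv, Prod.snd_add, inner_add_left]
  smul_mem' := by
    rintro c p ⟨g, hg, hp⟩
    refine ⟨c • g, (H10 P.D).smul_mem c hg, fun v h hv => ?_⟩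
    rw [form_smul, hp v h hv, Prod.smul_snd, inner_smul_left]
    simp

/-- The operator `A = -∇·(κ∇)` realised as an unbounded operator in `L²(D)`, with
`D(A) = {u ∈ H¹₀(D) : Au ∈ L²(D)}`. -/
def op : L2 P.D →ₗ.[ℝ] L2 P.D := P.opGraph.toLinearPMap

end DirichletData

/-- An `L²` function that vanishes against all test functions is zero. -/
theorem eq_zero_of_test {d : ℕ} {D : Set (EuclideanSpace ℝ (Fin d))} (hD : IsOpen D) (f : L2 D)
    (hf : ∀ φ, IsTest D φ → ∫ x in D, φ x * f x = 0) : f = 0 := by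
  have hloc : LocallyIntegrableOn f D volume :=
    locallyIntegrableOn_of_locallyIntegrable_restrict
      ((Lp.memLp f).locallyIntegrable (by norm_num))
  have key := hD.ae_eq_zero_of_integral_contDiff_smul_eq_zero hloc (fun φ h1 h2 h3 => by
    have := hf φ ⟨h1, h2, h3⟩
    rw [← this]
    refine (setIntegral_eq_integral_of_forall_compl_eq_zero fun x hx => ?_).symm
    have : x ∉ tsupport φ := fun h => hx (h3 h)
    simp [image_eq_zero_of_notMem_tsupport this])
  rw [Lp.eq_zero_iff_ae_eq_zero]
  filter_upwards [ae_restrict_of_ae key, ae_restrict_mem hD.measurableSet] with x hx hxD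
  exact hx hxD

theorem IsTest.memLp {d : ℕ} {D : Set (EuclideanSpace ℝ (Fin d))}
    {φ : EuclideanSpace ℝ (Fin d) → ℝ} (hφ : IsTest D φ) :
    MemLp φ 2 (volume.restrict D) :=
  (hφ.contDiff.continuous.memLp_of_hasCompactSupport hφ.hasCompactSupport).restrict D

theorem IsTest.partialDeriv {d : ℕ} {D : Set (EuclideanSpace ℝ (Fin d))}
    {φ : EuclideanSpace ℝ (Fin d) → ℝ} (hφ : IsTest D φ) (i : Fin d) :
    IsTest D (partialDeriv i φ) where
  contDiff := (hφ.contDiff.fderiv_right (m := ∞) (by simp)).clm_apply contDiff_const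
  hasCompactSupport := hφ.hasCompactSupport.fderiv_apply ℝ _
  tsupport_subset := (closure_mono (fun x hx => by
    by_contra hx'
    have : fderiv ℝ φ x = 0 := by
      by_contra h
      exact hx' (support_fderiv_subset ℝ h)
    exact hx (by simp [EllipticSemigroup.partialDeriv, this]))).trans
    ((isClosed_tsupport φ).closure_eq.le.trans hφ.tsupport_subset)

theorem toLp_inner {d : ℕ} {D : Set (EuclideanSpace ℝ (Fin d))}
    {φ : EuclideanSpace ℝ (Fin d) → ℝ} (hφ : MemLp φ 2 (volume.restrict D)) (u : L2 D) :
    inner ℝ (hφ.toLp φ) u = ∫ x in D, φ x * u x := by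
  rw [L2.inner_def]
  refine integral_congr_ae ?_
  filter_upwards [hφ.coeFn_toLp] with x hx
  simp [hx, mul_comm]

/-- The second component of an element of `H10` is the weak gradient of the first one. -/
theorem H10_weak_gradient {d : ℕ} {D : Set (EuclideanSpace ℝ (Fin d))}
    {u : L2 D} {g : Fin d → L2 D} (h : (u, g) ∈ H10 D)
    {φ : EuclideanSpace ℝ (Fin d) → ℝ} (hφ : IsTest D φ) (i : Fin d) :
    ∫ x in D, partialDeriv i φ x * u x = -∫ x in D, φ x * g i x := by
  rw [← toLp_inner (hφ.partialDeriv i).memLp, ← toLp_inner hφ.memLp]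
  have hcl : IsClosed {p : L2 D × (Fin d → L2 D) |
      inner ℝ ((hφ.partialDeriv i).memLp.toLp (partialDeriv i φ)) p.1
        = -inner ℝ (hφ.memLp.toLp φ) (p.2 i)} :=
    isClosed_eq (by fun_prop) (by fun_prop)
  refine closure_minimal (s := (testPairs D : Set _)) ?_ hcl h
  rintro p ⟨ψ, hψ, h1, h2⟩
  rw [Set.mem_ofPred_eq, toLp_inner, toLp_inner]
  have e1 : ∫ x in D, partialDeriv i φ x * p.1 x = ∫ x, partialDeriv i φ x * ψ x := by
    have h3 : ∫ x in D, partialDeriv i φ x * p.1 x = ∫ x in D, partialDeriv i φ x * ψ x := by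
      refine integral_congr_ae ?_
      filter_upwards [h1] with x hx
      rw [hx]
    refine h3.trans (setIntegral_eq_integral_of_forall_compl_eq_zero fun x hx => ?_)
    have : x ∉ tsupport ψ := fun h => hx (hψ.tsupport_subset h)
    simp [image_eq_zero_of_notMem_tsupport this]
  have e2 : ∫ x in D, φ x * p.2 i x = ∫ x, φ x * partialDeriv i ψ x := by
    have h3 : ∫ x in D, φ x * p.2 i x = ∫ x in D, φ x * partialDeriv i ψ x := by
      refine integral_congr_ae ?_
      filter_upwards [h2 i] with x hx
      rw [hx]
    refine h3.trans (setIntegral_eq_integral_of_forall_compl_eq_zero fun x hx => ?_)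
    have : x ∉ tsupport φ := fun h => hx (hφ.tsupport_subset h)
    simp [image_eq_zero_of_notMem_tsupport this]
  rw [e1, e2]
  have hc : ∀ {a b : EuclideanSpace ℝ (Fin d) → ℝ}, IsTest D a → IsTest D b →
      Integrable (fun x => a x * b x) volume := fun ha hb =>
    (ha.contDiff.continuous.mul hb.contDiff.continuous).integrable_of_hasCompactSupport
      (ha.hasCompactSupport.mul_right)
  have := integral_mul_fderiv_eq_neg_fderiv_mul_of_integrable (μ := volume) (𝕜 := ℝ)
    (f := φ) (g := ψ) (v := EuclideanSpace.single i 1)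
    (hc (hφ.partialDeriv i) hψ) (hc hφ (hψ.partialDeriv i)) (hc hφ hψ)
    (fun x _ => hφ.contDiff.differentiable (by simp) x)
    (fun x _ => hψ.contDiff.differentiable (by simp) x)
  simp only [partialDeriv]
  rw [this, neg_neg]

/-- `opGraph` is single-valued, so that `op` has exactly this graph. -/
theorem DirichletData.graph_op {d : ℕ} (P : DirichletData d) : P.op.graph = P.opGraph := by
  refine Submodule.toLinearPMap_graph_eq _ ?_
  rintro ⟨u, f⟩ ⟨g, hg, hf⟩ (rfl : u = 0)
  have hg0 : g = 0 := by
    funext i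
    refine eq_zero_of_test P.isOpen _ fun φ hφ => ?_
    have := H10_weak_gradient hg hφ i
    have h0 : ∫ x in P.D, EllipticSemigroup.partialDeriv i φ x * (0 : L2 P.D) x = 0 := by
      rw [← toLp_inner (hφ.partialDeriv i).memLp, inner_zero_right]
    linarith
  refine eq_zero_of_test P.isOpen _ fun φ hφ => ?_
  have hmem : (hφ.memLp.toLp φ, fun i => (hφ.partialDeriv i).memLp.toLp _) ∈ H10 P.D :=
    (testPairs P.D).le_topologicalClosure
      ⟨φ, hφ, hφ.memLp.coeFn_toLp, fun i => (hφ.partialDeriv i).memLp.coeFn_toLp⟩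
  have h1 := hf _ _ hmem
  have h2 := P.form_smul 0 0 (fun i => (hφ.partialDeriv i).memLp.toLp _)
  rw [hg0] at h1
  rw [← toLp_inner hφ.memLp, real_inner_comm, ← h1]
  simpa using h2

/-! ### Operators derived from `A` -/

section Abstract

variable {H : Type*} [NormedAddCommGroup H] [InnerProductSpace ℝ H]

/-- The operator `I + cA` with domain `D(A)`. -/
def onePlus (A : H →ₗ.[ℝ] H) (c : ℝ) : H →ₗ.[ℝ] H :=
  (LinearMap.id : H →ₗ[ℝ] H).toPMap ⊤ + c • A

/-- The product `ST` of unbounded operators, with `D(ST) = {x ∈ D(T) : Tx ∈ D(S)}`. -/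
def opMul (S T : H →ₗ.[ℝ] H) : H →ₗ.[ℝ] H where
  domain := (S.domain.comap T.toFun).map T.domain.subtype
  toFun :=
    { toFun := fun x => S ⟨T ⟨x, by
          obtain ⟨y, _, hy⟩ := x.2
          exact hy ▸ y.2⟩, by
          obtain ⟨_, y, hy, rfl⟩ := x
          exact hy⟩
      map_add' := fun x y => by
        rw [← S.map_add]
        congr 1
        apply Subtype.ext
        exact T.map_add ⟨x, _⟩ ⟨y, _⟩
      map_smul' := fun c x => by
        rw [RingHom.id_apply, ← S.map_smul]
        congr 1
        apply Subtype.ext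
        exact T.map_smul c ⟨x, _⟩ }

/-- `R_{k/2} = (I + (k/2) A)⁻¹`. -/
def stepResolvent (A : H →ₗ.[ℝ] H) (k : ℝ) : H →ₗ.[ℝ] H :=
  (onePlus A (k / 2)).inverse

/-- `𝒜_k = A M_k R_{k/2}²` with `M_k = I + (k/4) A`. -/
def modifiedOp (A : H →ₗ.[ℝ] H) (k : ℝ) : H →ₗ.[ℝ] H :=
  opMul A (opMul (onePlus A (k / 4)) (opMul (stepResolvent A k) (stepResolvent A k)))

/-- `(E(t))_{t ≥ 0}` is a strongly continuous semigroup of bounded operators and `B` is its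
infinitesimal generator: `Bx = lim_{h ↓ 0} (E(h)x - x)/h`, with `D(B)` the set of all `x` for which
this limit exists. (Values of `E` at negative times play no role.) -/
structure IsSemigroupGeneratedBy (E : ℝ → H →L[ℝ] H) (B : H →ₗ.[ℝ] H) : Prop where
  zero : E 0 = ContinuousLinearMap.id ℝ H
  add : ∀ s t : ℝ, 0 ≤ s → 0 ≤ t → E (s + t) = (E s).comp (E t)
  continuousOn : ∀ x : H, ContinuousOn (fun t => E t x) (Set.Ici 0)
  generator : ∀ x y : H,
    (x, y) ∈ B.graph ↔ Tendsto (fun h : ℝ => h⁻¹ • (E h x - x)) (𝓝[>] 0) (𝓝 y)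

/-- `e` is an orthonormal basis of eigenvectors of `A` with non-decreasing positive eigenvalues
`lam j → ∞`. -/
structure IsEigenbasis (A : H →ₗ.[ℝ] H) (lam : ℕ → ℝ) (e : HilbertBasis ℕ ℝ H) : Prop where
  pos : ∀ j, 0 < lam j
  monotone : Monotone lam
  tendsto : Tendsto lam atTop atTop
  eigen : ∀ j, (e j, lam j • e j) ∈ A.graph

/-- `x ∈ Ḣˢ` (for `s ≥ 0`), that is `x ∈ H` and `∑ⱼ λⱼˢ ⟨x,eⱼ⟩² < ∞`. -/
def MemHdot (lam : ℕ → ℝ) (e : HilbertBasis ℕ ℝ H) (s : ℝ) (x : H) : Prop :=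
  Summable fun j => lam j ^ s * inner ℝ x (e j) ^ 2

/-- `‖x‖_s = (∑ⱼ λⱼˢ ⟨x,eⱼ⟩²)^{1/2}`. -/
def normHdot (lam : ℕ → ℝ) (e : HilbertBasis ℕ ℝ H) (s : ℝ) (x : H) : ℝ :=
  Real.sqrt (∑' j, lam j ^ s * inner ℝ x (e j) ^ 2)

end Abstract

end EllipticSemigroup

end

namespace EllipticSemigroup

/-! ### Scalar estimates -/

/-! Every operator involved is diagonal in the basis `e`, so both errors are Fourier multipliers and
the theorem reduces to scalar bounds, uniform in the eigenvalue `l`. Put `z = k l`, `w = t l`, and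
let `m = l (1 + z/4) / (1 + z/2)²` be the eigenvalue of `𝒜_k`. The smoothed error has symbol `G =
exp(-w) - exp(-t m) (1 + z/2)⁻¹`, and the claim becomes `|G| ≤ 9 z^(s/2) w^(-r/2)`. It is checked at
the corners `(s, r) = (0, 0), (2, 0), (2, 2)`, with constants 1, 2 and 9, and the rest follows by
geometric interpolation (`le_mul_rpow_of_le`). The delicate corner is `(2, 2)`, in
`abs_exp_sub_smoothed_mul_le`: since `m < 1/k`, `exp(-t m)` alone does not damp high frequencies,
and the resolvent factor supplies the missing decay.

The passage to symbols uses only the generator property: `inner_apply` diagonalises a semigroup from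
eigenvectors of its generator, and `mem_graph_of_inner` shows that the domain of the generator is as
large as the coefficients allow, which makes the resolvent everywhere defined. -/

theorem mul_exp_neg_le_one (x : ℝ) : x * Real.exp (-x) ≤ 1 := by
  rw [Real.exp_neg, ← div_eq_mul_inv, div_le_one (Real.exp_pos x)]
  linarith [Real.add_one_le_exp x]

theorem sq_mul_exp_neg_le_two {x : ℝ} (hx : 0 ≤ x) : x ^ 2 * Real.exp (-x) ≤ 2 := by
  rw [Real.exp_neg, ← div_eq_mul_inv, div_le_iff₀ (Real.exp_pos x)]
  linarith [Real.quadratic_le_exp_of_nonneg hx]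

/-- The eigenvalue of `𝒜_k` corresponding to the eigenvalue `l` of `A`. -/
noncomputable def modifiedEigenvalue (k l : ℝ) : ℝ := l * ((1 + k / 4 * l) * ((1 + k / 2 * l)⁻¹) ^ 2)

theorem modifiedEigenvalue_nonneg {k l : ℝ} (hk : 0 ≤ k) (hl : 0 ≤ l) :
    0 ≤ modifiedEigenvalue k l := by
  unfold modifiedEigenvalue; positivity

theorem modifiedEigenvalue_le {k l : ℝ} (hk : 0 ≤ k) (hl : 0 ≤ l) :
    modifiedEigenvalue k l ≤ l := by
  unfold modifiedEigenvalue
  refine mul_le_of_le_one_right hl ?_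
  have hz : 0 ≤ k * l := by positivity
  rw [inv_pow, ← div_eq_mul_inv, div_le_one (by positivity)]
  nlinarith [sq_nonneg (k * l)]

/-- With `z = k l` this is `(1 + z/2)² ≤ (1 + z)(1 + z/4)`. Having the modified eigenvalue `m` on
the right, not `l`, produces `t m exp(-t m)` later, which is bounded uniformly in `t`. -/
theorem sub_modifiedEigenvalue_le {k l : ℝ} (hk : 0 ≤ k) (hl : 0 ≤ l) :
    l - modifiedEigenvalue k l ≤ k * l * modifiedEigenvalue k l := by
  have hz : 0 ≤ k * l := by positivity
  have h : 1 ≤ (1 + k * l) * ((1 + k / 4 * l) * ((1 + k / 2 * l)⁻¹) ^ 2) := by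
    rw [inv_pow, ← mul_assoc, ← div_eq_mul_inv, one_le_div (by positivity)]
    nlinarith
  unfold modifiedEigenvalue
  nlinarith [mul_le_mul_of_nonneg_left h hl]

/-- The factor `1 + k l` would do; `2 + k l = 2 (1 + k l / 2)` is chosen to cancel against the
resolvent symbol. -/
theorem le_mul_modifiedEigenvalue {k l : ℝ} (hk : 0 ≤ k) (hl : 0 ≤ l) :
    l ≤ (2 + k * l) * modifiedEigenvalue k l := by
  have hz : 0 ≤ k * l := by positivity
  have h : 1 ≤ (2 + k * l) * ((1 + k / 4 * l) * ((1 + k / 2 * l)⁻¹) ^ 2) := by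
    rw [inv_pow, ← mul_assoc, ← div_eq_mul_inv, one_le_div (by positivity)]
    nlinarith
  unfold modifiedEigenvalue
  nlinarith [mul_le_mul_of_nonneg_left h hl]

/-! ### Bounds for the symbols of the two error operators. -/

section Symbols

variable {k l t : ℝ}

/-- Since `m ≤ l`, the larger exponential `exp(-t m)` can be factored out, and `1 - exp(-y) ≤ y`
applies with `y = t (l - m)`. -/
theorem abs_exp_sub_exp_modified_le (hk : 0 < k) (hl : 0 < l) (ht : 0 < t) :
    |Real.exp (-(t * l)) - Real.exp (-(t * modifiedEigenvalue k l))| ≤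
      k * l * (t * modifiedEigenvalue k l * Real.exp (-(t * modifiedEigenvalue k l))) := by
  set m := modifiedEigenvalue k l
  have hml : t * m ≤ t * l := mul_le_mul_of_nonneg_left (modifiedEigenvalue_le hk.le hl.le) ht.le
  have hle : Real.exp (-(t * l)) ≤ Real.exp (-(t * m)) := Real.exp_le_exp.2 (by linarith)
  rw [abs_sub_comm, abs_of_nonneg (by linarith)]
  have h1 : Real.exp (-(t * l)) = Real.exp (-(t * m)) * Real.exp (-(t * (l - m))) := by
    rw [← Real.exp_add]; congr 1; ring
  have h2 := Real.add_one_le_exp (-(t * (l - m)))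
  have h3 : t * (l - m) ≤ t * (k * l * m) :=
    mul_le_mul_of_nonneg_left (sub_modifiedEigenvalue_le hk.le hl.le) ht.le
  have h4 := Real.exp_pos (-(t * m))
  calc _ = Real.exp (-(t * m)) * (1 - Real.exp (-(t * (l - m)))) := by rw [h1]; ring
    _ ≤ Real.exp (-(t * m)) * (t * (k * l * m)) := by gcongr; linarith
    _ = _ := by ring

theorem abs_exp_sub_exp_modified_le_self (hk : 0 < k) (hl : 0 < l) (ht : 0 < t) :
    |Real.exp (-(t * l)) - Real.exp (-(t * modifiedEigenvalue k l))| ≤ k * l :=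
  (abs_exp_sub_exp_modified_le hk hl ht).trans
    (mul_le_of_le_one_right (by positivity) (mul_exp_neg_le_one _))

theorem abs_exp_sub_exp_modified_le_one (hk : 0 < k) (hl : 0 < l) (ht : 0 < t) :
    |Real.exp (-(t * l)) - Real.exp (-(t * modifiedEigenvalue k l))| ≤ 1 := by
  have hm := modifiedEigenvalue_nonneg hk.le hl.le
  have h1 : Real.exp (-(t * l)) ≤ 1 := Real.exp_le_one_iff.2 (by simp; positivity)
  have h2 : Real.exp (-(t * modifiedEigenvalue k l)) ≤ 1 :=
    Real.exp_le_one_iff.2 (by simp; positivity)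
  rw [abs_le]
  constructor <;> linarith [Real.exp_pos (-(t * l)), Real.exp_pos (-(t * modifiedEigenvalue k l))]

/-- The smoothing factor `(1 + kl/2)⁻¹` contributes an error of order `kl`. -/
theorem abs_exp_sub_smoothed_le_add (hk : 0 < k) (hl : 0 < l) (ht : 0 < t) :
    |Real.exp (-(t * l)) - Real.exp (-(t * modifiedEigenvalue k l)) * (1 + k / 2 * l)⁻¹| ≤
      k * l * (t * modifiedEigenvalue k l * Real.exp (-(t * modifiedEigenvalue k l))) +
        k * l * Real.exp (-(t * modifiedEigenvalue k l)) := by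
  have hz : 0 < k * l := by positivity
  have hy := Real.exp_pos (-(t * modifiedEigenvalue k l))
  have h1 : (1 + k / 2 * l)⁻¹ ≤ 1 := inv_le_one_of_one_le₀ (by nlinarith)
  have h2 : 1 - (1 + k / 2 * l)⁻¹ ≤ k * l := by
    have h3 : 1 - (1 + k / 2 * l)⁻¹ = k / 2 * l * (1 + k / 2 * l)⁻¹ := by
      field_simp; ring
    rw [h3]
    nlinarith
  have h4 : |Real.exp (-(t * modifiedEigenvalue k l)) -
      Real.exp (-(t * modifiedEigenvalue k l)) * (1 + k / 2 * l)⁻¹| ≤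
      k * l * Real.exp (-(t * modifiedEigenvalue k l)) := by
    rw [abs_of_nonneg (by nlinarith)]
    nlinarith
  exact (abs_sub_le _ _ _).trans (add_le_add (abs_exp_sub_exp_modified_le hk hl ht) h4)

theorem abs_exp_sub_smoothed_le_self (hk : 0 < k) (hl : 0 < l) (ht : 0 < t) :
    |Real.exp (-(t * l)) - Real.exp (-(t * modifiedEigenvalue k l)) * (1 + k / 2 * l)⁻¹| ≤
      2 * (k * l) := by
  have hz : 0 < k * l := by positivity
  have hm := modifiedEigenvalue_nonneg hk.le hl.le
  have h1 := mul_exp_neg_le_one (t * modifiedEigenvalue k l)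
  have h2 : Real.exp (-(t * modifiedEigenvalue k l)) ≤ 1 :=
    Real.exp_le_one_iff.2 (by simp; positivity)
  refine (abs_exp_sub_smoothed_le_add hk hl ht).trans ?_
  nlinarith

theorem abs_exp_sub_smoothed_le_one (hk : 0 < k) (hl : 0 < l) (ht : 0 < t) :
    |Real.exp (-(t * l)) - Real.exp (-(t * modifiedEigenvalue k l)) * (1 + k / 2 * l)⁻¹| ≤ 1 := by
  have hz : 0 < k * l := by positivity
  have hm := modifiedEigenvalue_nonneg hk.le hl.le
  have h0 : Real.exp (-(t * l)) ≤ 1 := Real.exp_le_one_iff.2 (by simp; positivity)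
  have h2 : Real.exp (-(t * modifiedEigenvalue k l)) ≤ 1 :=
    Real.exp_le_one_iff.2 (by simp; positivity)
  have h1 : (1 + k / 2 * l)⁻¹ ≤ 1 := inv_le_one_of_one_le₀ (by nlinarith)
  have h3 : 0 < Real.exp (-(t * modifiedEigenvalue k l)) * (1 + k / 2 * l)⁻¹ := by positivity
  have h4 := mul_le_one₀ h2 (by positivity) h1
  rw [abs_le]
  constructor <;> linarith [Real.exp_pos (-(t * l))]

theorem abs_exp_sub_smoothed_mul_le (hk : 0 < k) (hl : 0 < l) (ht : 0 < t) :
    |Real.exp (-(t * l)) - Real.exp (-(t * modifiedEigenvalue k l)) * (1 + k / 2 * l)⁻¹| *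
      (t * l) ≤ 9 * (k * l) := by
  have hz : 0 < k * l := by positivity
  have hm := modifiedEigenvalue_nonneg hk.le hl.le
  have hw : t * l ≤ (2 + k * l) * (t * modifiedEigenvalue k l) := by
    have := mul_le_mul_of_nonneg_left (le_mul_modifiedEigenvalue hk.le hl.le) ht.le
    linarith
  have hadd := abs_exp_sub_smoothed_le_add hk hl ht
  have hv : 0 ≤ t * modifiedEigenvalue k l := by positivity
  have h1 := mul_exp_neg_le_one (t * modifiedEigenvalue k l)
  set v := t * modifiedEigenvalue k l
  have hv' := Real.exp_pos (-v)
  rcases le_total (k * l) 1 with hz1 | hz1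
  -- Low frequencies: `l ≤ 3 m`, so the powers of `v` are absorbed by `exp(-v)`; the constant is `3
  -- * 2 + 3 * 1 = 9`.
  · have h2 := sq_mul_exp_neg_le_two hv
    have h3 : t * l ≤ 3 * v := by nlinarith
    calc _ ≤ (k * l * (v * Real.exp (-v)) + k * l * Real.exp (-v)) * (3 * v) := by
          gcongr
      _ = k * l * (3 * (v ^ 2 * Real.exp (-v)) + 3 * (v * Real.exp (-v))) := by ring
      _ ≤ k * l * 9 := by gcongr; linarith
      _ = _ := by ring
  -- High frequencies: no cancellation between the exponentials is needed. The two terms contribute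
  -- at most 1 and 2, and `3 ≤ 9 k l`.
  · have h3 := mul_exp_neg_le_one (t * l)
    have h4 : |Real.exp (-(t * l)) - Real.exp (-v) * (1 + k / 2 * l)⁻¹| ≤
        Real.exp (-(t * l)) + Real.exp (-v) * (1 + k / 2 * l)⁻¹ := by
      have h5 : 0 < Real.exp (-v) * (1 + k / 2 * l)⁻¹ := by positivity
      rw [abs_le]
      constructor <;> linarith [Real.exp_pos (-(t * l))]
    have h6 : (2 + k * l) = 2 * (1 + k / 2 * l) := by ring
    have h7 : Real.exp (-v) * (1 + k / 2 * l)⁻¹ * (t * l) ≤ 2 * (v * Real.exp (-v)) := by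
      calc _ ≤ Real.exp (-v) * (1 + k / 2 * l)⁻¹ * ((2 + k * l) * v) := by gcongr
        _ = _ := by rw [h6]; field_simp
    calc _ ≤ (Real.exp (-(t * l)) + Real.exp (-v) * (1 + k / 2 * l)⁻¹) * (t * l) := by gcongr
      _ ≤ 3 := by rw [add_mul]; linarith
      _ ≤ _ := by linarith

end Symbols

/-- Geometric interpolation between three bounds. -/
theorem le_mul_rpow_of_le {G C z w a b : ℝ} (hG : 0 ≤ G) (hC : 0 ≤ C) (hz : 0 ≤ z)
    (hw : 0 < w) (h0 : G ≤ C) (h1 : G ≤ C * z) (h2 : G * w ≤ C * z)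
    (hb : 0 ≤ b) (hba : b ≤ a) (ha : a ≤ 1) : G ≤ C * z ^ a * w ^ (-b) := by
  have h2' : G ≤ C * (z * w⁻¹) := by
    rw [← mul_assoc, ← div_eq_mul_inv, le_div_iff₀ hw]; exact h2
  -- The weights of the three bounds are nonnegative and sum to 1; their signs let the identity
  -- include `x = 0`, which `G` may attain.
  have hpow : ∀ {x : ℝ}, 0 ≤ x → x ^ (1 - a) * x ^ (a - b) * x ^ b = x := fun {x} hx => by
    rw [← Real.rpow_add_of_nonneg hx (by linarith) (by linarith),
      ← Real.rpow_add_of_nonneg hx (by linarith) hb]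
    ring_nf
    exact Real.rpow_one x
  calc G = G ^ (1 - a) * G ^ (a - b) * G ^ b := (hpow hG).symm
    _ ≤ C ^ (1 - a) * (C * z) ^ (a - b) * (C * (z * w⁻¹)) ^ b := by
        gcongr
    _ = (C ^ (1 - a) * C ^ (a - b) * C ^ b) * (z ^ (a - b) * z ^ b) * (w⁻¹) ^ b := by
        rw [Real.mul_rpow hC hz, Real.mul_rpow hC (by positivity),
          Real.mul_rpow hz (by positivity)]
        ring
    _ = C * z ^ a * w ^ (-b) := by
        rw [hpow hC, ← Real.rpow_add_of_nonneg hz (by linarith) hb, sub_add_cancel,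
          Real.inv_rpow hw.le, Real.rpow_neg hw.le]

theorem abs_exp_sub_smoothed_le_rpow {k l t r s : ℝ} (hk : 0 < k) (hl : 0 < l) (ht : 0 < t)
    (hr : 0 ≤ r) (hrs : r ≤ s) (hs : s ≤ 2) :
    |Real.exp (-(t * l)) - Real.exp (-(t * modifiedEigenvalue k l)) * (1 + k / 2 * l)⁻¹| ≤
      9 * k ^ (s / 2) * t ^ (-(r / 2)) * l ^ ((s - r) / 2) := by
  have hz : 0 < k * l := by positivity
  have h := le_mul_rpow_of_le (abs_nonneg _) (by norm_num : (0 : ℝ) ≤ 9) hz.le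
    (by positivity : 0 < t * l)
    ((abs_exp_sub_smoothed_le_one hk hl ht).trans (by norm_num))
    ((abs_exp_sub_smoothed_le_self hk hl ht).trans (by linarith))
    (abs_exp_sub_smoothed_mul_le hk hl ht)
    (by linarith : 0 ≤ r / 2) (by linarith : r / 2 ≤ s / 2) (by linarith)
  refine h.trans_eq ?_
  rw [Real.mul_rpow hk.le hl.le, Real.mul_rpow ht.le hl.le,
    show (s - r) / 2 = s / 2 + -(r / 2) by ring, Real.rpow_add hl]
  ring

theorem abs_exp_sub_exp_modified_le_rpow {k l t s : ℝ} (hk : 0 < k) (hl : 0 < l) (ht : 0 < t)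
    (hs0 : 0 ≤ s) (hs : s ≤ 2) :
    |Real.exp (-(t * l)) - Real.exp (-(t * modifiedEigenvalue k l))| ≤
      9 * k ^ (s / 2) * l ^ (s / 2) := by
  have hz : 0 < k * l := by positivity
  have h1 := abs_exp_sub_exp_modified_le_self hk hl ht
  -- Without the resolvent there is no smoothing corner; `w = 1`, `b = 0` leaves only the
  -- interpolation in `s`.
  have h := le_mul_rpow_of_le (w := 1) (b := 0) (a := s / 2) (abs_nonneg _)
    (by norm_num : (0 : ℝ) ≤ 9) hz.le one_pos
    ((abs_exp_sub_exp_modified_le_one hk hl ht).trans (by norm_num))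
    (h1.trans (by linarith)) (by linarith) le_rfl (by linarith) (by linarith)
  refine h.trans_eq ?_
  rw [Real.mul_rpow hk.le hl.le, Real.one_rpow]
  ring

/-! ### Expansions in a Hilbert basis -/

section Abstract

variable {H : Type*} [NormedAddCommGroup H] [InnerProductSpace ℝ H]

theorem hasSum_sq_inner (e : HilbertBasis ℕ ℝ H) (x : H) :
    HasSum (fun j => inner ℝ x (e j) ^ 2) (‖x‖ ^ 2) := by
  have h := e.hasSum_inner_mul_inner x x
  rw [real_inner_self_eq_norm_sq] at h
  convert! h using 2 with j
  rw [real_inner_comm x, sq]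

theorem eq_of_inner_eq (e : HilbertBasis ℕ ℝ H) {x y : H}
    (h : ∀ j, inner ℝ x (e j) = inner ℝ y (e j)) : x = y := by
  apply e.repr.injective
  ext j
  rw [e.repr_apply_apply, e.repr_apply_apply, real_inner_comm, h j, real_inner_comm]

/-- Bounded sequences act on `H` as Fourier multipliers. -/
theorem exists_multiplier (e : HilbertBasis ℕ ℝ H) {m : ℕ → ℝ} {M : ℝ} (hm : ∀ j, |m j| ≤ M)
    (x : H) : ∃ y : H, ∀ j, inner ℝ y (e j) = m j * inner ℝ x (e j) := by
  have hmem : Memℓp (fun j => m j * inner ℝ x (e j)) 2 := by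
    rw [memℓp_gen_iff (by norm_num)]
    refine Summable.of_nonneg_of_le (fun j => by positivity) (fun j => ?_)
      ((hasSum_sq_inner e x).summable.mul_left (M ^ 2))
    have : ‖m j * inner ℝ x (e j)‖ ^ (2 : ENNReal).toReal = m j ^ 2 * inner ℝ x (e j) ^ 2 := by
      simp [mul_pow]
    rw [this]
    gcongr ?_ * _
    exact sq_le_sq' (abs_le.1 (hm j)).1 (abs_le.1 (hm j)).2
  refine ⟨e.repr.symm ⟨_, hmem⟩, fun j => ?_⟩
  rw [real_inner_comm, ← e.repr_apply_apply, LinearIsometryEquiv.apply_symm_apply]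

/-- Parseval: this is where a symbol bound becomes an operator bound. -/
theorem norm_le_mul_normHdot {lam : ℕ → ℝ} {e : HilbertBasis ℕ ℝ H} (hlam : ∀ j, 0 < lam j)
    {σ K : ℝ} (hK : 0 ≤ K) {x y : H} (hx : MemHdot lam e σ x)
    (h : ∀ j, |inner ℝ y (e j)| ≤ K * lam j ^ (σ / 2) * |inner ℝ x (e j)|) :
    ‖y‖ ≤ K * normHdot lam e σ x := by
  have hK' : 0 ≤ K * normHdot lam e σ x := mul_nonneg hK (Real.sqrt_nonneg _)
  rw [← pow_le_pow_iff_left₀ (norm_nonneg y) hK' two_ne_zero, mul_pow, normHdot, Real.sq_sqrt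
    (tsum_nonneg fun j => by have := hlam j; positivity), ← tsum_mul_left,
    ← (hasSum_sq_inner e y).tsum_eq]
  refine (hasSum_sq_inner e y).summable.tsum_le_tsum (fun j => ?_) (hx.mul_left _)
  calc inner ℝ y (e j) ^ 2 = |inner ℝ y (e j)| ^ 2 := (sq_abs _).symm
    _ ≤ (K * lam j ^ (σ / 2) * |inner ℝ x (e j)|) ^ 2 := by gcongr; exact h j
    _ = K ^ 2 * (lam j ^ σ * inner ℝ x (e j) ^ 2) := by
      rw [mul_pow, mul_pow, sq_abs, ← Real.rpow_natCast (lam j ^ (σ / 2)),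
        ← Real.rpow_mul (hlam j).le]
      push_cast
      rw [div_mul_cancel₀ σ two_ne_zero, mul_assoc]

/-! ### Graphs of derived operators -/

theorem mem_graph_onePlus {A : H →ₗ.[ℝ] H} (c : ℝ) {x y : H} (h : (x, y) ∈ A.graph) :
    (x, x + c • y) ∈ (onePlus A c).graph := by
  obtain ⟨u, rfl, rfl⟩ := (LinearPMap.mem_graph_iff A).1 h
  exact (LinearPMap.mem_graph_iff _).2 ⟨⟨u, trivial, u.2⟩, rfl, rfl⟩

theorem exists_of_mem_graph_onePlus {A : H →ₗ.[ℝ] H} {c : ℝ} {x z : H}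
    (h : (x, z) ∈ (onePlus A c).graph) : ∃ y, (x, y) ∈ A.graph ∧ z = x + c • y := by
  obtain ⟨u, rfl, rfl⟩ := (LinearPMap.mem_graph_iff _).1 h
  exact ⟨A ⟨u, u.2.2⟩, A.mem_graph ⟨u, u.2.2⟩, rfl⟩

theorem mem_graph_opMul {S T : H →ₗ.[ℝ] H} {x y z : H} (hT : (x, y) ∈ T.graph)
    (hS : (y, z) ∈ S.graph) : (x, z) ∈ (opMul S T).graph := by
  obtain ⟨u, rfl, rfl⟩ := (LinearPMap.mem_graph_iff _).1 hT
  obtain ⟨v, hv, rfl⟩ := (LinearPMap.mem_graph_iff _).1 hS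
  have hu : T u ∈ S.domain := by
    rw [show T u = v from hv.symm]
    exact v.2
  refine (LinearPMap.mem_graph_iff _).2 ⟨⟨u, u, hu, rfl⟩, rfl, ?_⟩
  show S ⟨T u, _⟩ = S v
  congr 1
  exact Subtype.ext hv.symm

theorem mem_graph_neg {B : H →ₗ.[ℝ] H} {x y : H} (h : (x, y) ∈ B.graph) :
    (x, -y) ∈ (-B).graph := by
  obtain ⟨u, rfl, rfl⟩ := (LinearPMap.mem_graph_iff _).1 h
  exact (LinearPMap.mem_graph_iff _).2 ⟨u, rfl, rfl⟩

theorem mem_graph_of_neg {B : H →ₗ.[ℝ] H} {x y : H} (h : (x, -y) ∈ (-B).graph) :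
    (x, y) ∈ B.graph := by
  obtain ⟨u, rfl, hu⟩ := (LinearPMap.mem_graph_iff _).1 h
  exact (LinearPMap.mem_graph_iff _).2 ⟨u, rfl, neg_injective hu⟩

/-! ### Semigroups on eigenvectors -/

namespace IsSemigroupGeneratedBy

variable {E : ℝ → H →L[ℝ] H} {B : H →ₗ.[ℝ] H}

/-- The function `a ↦ exp(a μ) • E a v` is constant. The generator gives only right derivatives, but
a continuous function with vanishing right derivative is constant. -/
theorem apply_eigenvector (hE : IsSemigroupGeneratedBy E (-B)) {v : H} {μ : ℝ}
    (hv : (v, μ • v) ∈ B.graph) {t : ℝ} (ht : 0 ≤ t) : E t v = Real.exp (-(t * μ)) • v := by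
  have hlim := (hE.generator _ _).1 (mem_graph_neg hv)
  have hderiv : ∀ a ∈ Set.Ico 0 t, HasDerivWithinAt (fun a => Real.exp (a * μ) • E a v) 0
      (Set.Ici a) a := by
    intro a ha
    have h1 : HasDerivWithinAt (fun a => E a v) (-(μ • E a v)) (Set.Ici a) a := by
      rw [← hasDerivWithinAt_Ioi_iff_Ici, hasDerivWithinAt_iff_tendsto_slope' (by simp)]
      have hshift : Tendsto (fun b => b - a) (𝓝[>] a) (𝓝[>] 0) := by
        refine tendsto_nhdsWithin_iff.2 ⟨?_, ?_⟩
        · have : Tendsto (fun b => b - a) (𝓝 a) (𝓝 (a - a)) :=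
            (continuous_id.sub continuous_const).tendsto a
          rw [sub_self] at this
          exact this.mono_left nhdsWithin_le_nhds
        · filter_upwards [self_mem_nhdsWithin] with b (hb : a < b)
          exact sub_pos.2 hb
      -- By the semigroup law, the right slope at `a` is `E a` applied to the difference quotient at
      -- 0.
      have h3 := ((E a).continuous.tendsto _).comp (hlim.comp hshift)
      rw [map_neg, map_smul] at h3
      refine h3.congr' ?_
      filter_upwards [self_mem_nhdsWithin] with b (hb : a < b)
      have h4 := hE.add a (b - a) ha.1 (sub_nonneg.2 hb.le)
      rw [add_sub_cancel] at h4
      simp [slope_def_module, h4]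
    have h2 : HasDerivWithinAt (fun a => Real.exp (a * μ)) (Real.exp (a * μ) * μ) (Set.Ici a) a :=
      ((hasDerivAt_mul_const μ).exp).hasDerivWithinAt
    convert! h2.smul h1 using 1
    rw [smul_neg, smul_smul]; simp
  have hcont : ContinuousOn (fun a => Real.exp (a * μ) • E a v) (Set.Icc 0 t) :=
    ContinuousOn.smul (by fun_prop) ((hE.continuousOn v).mono Set.Icc_subset_Ici_self)
  have := constant_of_has_deriv_right_zero hcont hderiv t ⟨ht, le_rfl⟩
  simp only [zero_mul, Real.exp_zero, one_smul, hE.zero, ContinuousLinearMap.id_apply] at this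
  nth_rw 2 [← this]
  rw [smul_smul, ← Real.exp_add, neg_add_cancel, Real.exp_zero, one_smul]

/-- Continuity of `E t` lets it act termwise on the expansion of `x`; symmetry of `E t` is not
required. -/
theorem inner_apply (hE : IsSemigroupGeneratedBy E (-B)) {e : HilbertBasis ℕ ℝ H} {μ : ℕ → ℝ}
    (he : ∀ j, (e j, μ j • e j) ∈ B.graph) {t : ℝ} (ht : 0 ≤ t) (x : H) (j : ℕ) :
    inner ℝ (E t x) (e j) = Real.exp (-(t * μ j)) * inner ℝ x (e j) := by
  have h := (e.hasSum_repr x).mapL ((innerSL ℝ (e j)).comp (E t))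
  have h2 : HasSum (fun i => ((innerSL ℝ (e j)).comp (E t)) (e.repr x i • e i))
      (Real.exp (-(t * μ j)) * inner ℝ x (e j)) := by
    have h1 : ((innerSL ℝ (e j)).comp (E t)) (e.repr x j • e j) =
        Real.exp (-(t * μ j)) * inner ℝ x (e j) := by
      simp [hE.apply_eigenvector (he j) ht, e.repr_apply_apply, real_inner_comm,
        e.orthonormal.1 j, mul_comm]
    rw [← h1]
    refine hasSum_single j fun i hi => ?_
    simp [hE.apply_eigenvector (he i) ht, e.orthonormal.2 hi.symm]
  have := h.unique h2
  rw [real_inner_comm]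
  simpa using this

/-- Differentiate the coefficient of `E a u` at `a = 0` in two ways. This takes the place of the
symmetry of `B`. -/
theorem inner_of_mem_graph (hE : IsSemigroupGeneratedBy E (-B)) {e : HilbertBasis ℕ ℝ H}
    {μ : ℕ → ℝ} (he : ∀ j, (e j, μ j • e j) ∈ B.graph) {u f : H} (h : (u, f) ∈ B.graph) (j : ℕ) :
    inner ℝ f (e j) = μ j * inner ℝ u (e j) := by
  have h1 := ((hE.generator _ _).1 (mem_graph_neg h)).inner (𝕜 := ℝ) (tendsto_const_nhds (x := e j))
  have h2 : HasDerivAt (fun a => Real.exp (-(a * μ j)) * inner ℝ u (e j))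
      (-(μ j) * inner ℝ u (e j)) 0 := by
    have := ((hasDerivAt_mul_const (x := 0) (μ j)).neg.exp).mul_const (inner ℝ u (e j))
    simpa using this
  have h3 := h2.tendsto_slope_zero_right
  have h4 := tendsto_nhds_unique h1 (h3.congr' ?_)
  · rw [inner_neg_left] at h4; linarith
  · filter_upwards [self_mem_nhdsWithin] with a (ha : 0 < a)
    simp [inner_smul_left, inner_sub_left, hE.inner_apply he ha.le]

/-- A semigroup that is diagonal in a Hilbert basis has the maximal diagonal generator. -/
theorem mem_graph_of_inner (hE : IsSemigroupGeneratedBy E (-B)) {e : HilbertBasis ℕ ℝ H}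
    {μ : ℕ → ℝ} (hμ : ∀ j, 0 < μ j) (he : ∀ j, (e j, μ j • e j) ∈ B.graph) {u f : H}
    (h : ∀ j, inner ℝ f (e j) = μ j * inner ℝ u (e j)) : (u, f) ∈ B.graph := by
  refine mem_graph_of_neg ((hE.generator _ _).2 ?_)
  rw [tendsto_iff_norm_sub_tendsto_zero]
  have hcoord : ∀ j, ∀ a : ℝ, 0 < a → inner ℝ (a⁻¹ • (E a u - u) - -f) (e j) =
      (a⁻¹ * (Real.exp (-(a * μ j)) - 1) + μ j) * inner ℝ u (e j) := by
    intro j a ha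
    simp [inner_smul_left, inner_sub_left, hE.inner_apply he ha.le, h j, inner_add_left]
    ring
  have hbound : ∀ j, ∀ a : ℝ, 0 < a → |a⁻¹ * (Real.exp (-(a * μ j)) - 1) + μ j| ≤ μ j := by
    intro j a ha
    have h1 : -(a * μ j) ≤ Real.exp (-(a * μ j)) - 1 := by
      linarith [Real.add_one_le_exp (-(a * μ j))]
    have h2 : Real.exp (-(a * μ j)) - 1 ≤ 0 := by
      have := hμ j
      linarith [Real.exp_le_one_iff.2 (by simp; positivity : -(a * μ j) ≤ 0)]
    have h3 := mul_le_mul_of_nonneg_left h1 (inv_pos.2 ha).le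
    have h4 := mul_nonpos_of_nonneg_of_nonpos (inv_pos.2 ha).le h2
    have h5 : a⁻¹ * -(a * μ j) = -μ j := by field_simp
    rw [abs_le]
    constructor <;> linarith [hμ j]
  -- By Parseval the sum is the squared distance of the difference quotient from `-f`. By `hbound`
  -- each term is at most `(μ j * inner ℝ u (e j))² = (inner ℝ f (e j))²`, a summable majorant.
  have hsq : Tendsto (fun a : ℝ => ∑' j, inner ℝ (a⁻¹ • (E a u - u) - -f) (e j) ^ 2) (𝓝[>] 0)
      (𝓝 (∑' _ : ℕ, (0 : ℝ))) := by
    refine tendsto_tsum_of_dominated_convergence (hasSum_sq_inner e f).summable (fun j => ?_) ?_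
    · have h2 : HasDerivAt (fun a => Real.exp (-(a * μ j))) (-(μ j)) 0 := by
        simpa using (hasDerivAt_mul_const (x := 0) (μ j)).neg.exp
      have h3 := (((h2.tendsto_slope_zero_right.add_const (μ j)).mul_const
        (inner ℝ u (e j))).pow 2)
      simp only [neg_add_cancel, zero_mul, ne_eq, OfNat.ofNat_ne_zero, not_false_eq_true,
        zero_pow] at h3
      refine h3.congr' ?_
      filter_upwards [self_mem_nhdsWithin] with a (ha : 0 < a)
      rw [hcoord j a ha]
      simp
    · filter_upwards [self_mem_nhdsWithin] with a (ha : 0 < a) j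
      rw [hcoord j a ha, h j, Real.norm_eq_abs, abs_of_nonneg (by positivity), mul_pow, mul_pow]
      gcongr ?_ * _
      exact sq_le_sq' (abs_le.1 (hbound j a ha)).1 (abs_le.1 (hbound j a ha)).2
  rw [tsum_zero] at hsq
  have := hsq.sqrt
  rw [Real.sqrt_zero] at this
  refine this.congr fun a => ?_
  rw [(hasSum_sq_inner e _).tsum_eq, Real.sqrt_sq (norm_nonneg _)]

end IsSemigroupGeneratedBy

/-! ### The resolvent and the modified operator -/

section Main

variable {A : H →ₗ.[ℝ] H} {lam : ℕ → ℝ} {e : HilbertBasis ℕ ℝ H} {k : ℝ}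
  {E Ek : ℝ → H →L[ℝ] H}

/-- Injectivity is what makes the graph of `LinearPMap.inverse` the flipped graph. -/
theorem ker_onePlus_eq_bot (he : IsEigenbasis A lam e) (hE : IsSemigroupGeneratedBy E (-A))
    {c : ℝ} (hc : 0 < c) : (onePlus A c).toFun.ker = ⊥ := by
  rw [LinearMap.ker_eq_bot']
  intro u hu
  obtain ⟨y, hy, h0⟩ := exists_of_mem_graph_onePlus ((onePlus A c).mem_graph u)
  rw [show onePlus A c u = 0 from hu] at h0
  refine Subtype.ext (eq_of_inner_eq e fun j => ?_)
  have h1 := hE.inner_of_mem_graph he.eigen hy j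
  have h2 := congrArg (fun z => inner ℝ z (e j)) h0
  simp only [inner_zero_left, inner_add_left, inner_smul_left, h1] at h2
  have h3 : (1 + c * lam j) * inner ℝ (u : H) (e j) = 0 := by
    rw [h2]; simp; ring
  have := he.pos j
  rcases mul_eq_zero.1 h3 with h4 | h4
  · exact absurd h4 (by positivity)
  · simpa using h4

theorem mem_graph_stepResolvent (he : IsEigenbasis A lam e) (hE : IsSemigroupGeneratedBy E (-A))
    (hk : 0 < k) {x y : H} (h : (x, y) ∈ (onePlus A (k / 2)).graph) :
    (y, x) ∈ (stepResolvent A k).graph := by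
  obtain ⟨u, rfl, rfl⟩ := (LinearPMap.mem_graph_iff _).1 h
  exact LinearPMap.mem_inverse_graph (ker_onePlus_eq_bot he hE (half_pos hk)) u

theorem exists_stepResolvent (he : IsEigenbasis A lam e) (hE : IsSemigroupGeneratedBy E (-A))
    (hk : 0 < k) (x : H) : ∃ y, (x, y) ∈ (stepResolvent A k).graph ∧
      ∀ j, inner ℝ y (e j) = (1 + k / 2 * lam j)⁻¹ * inner ℝ x (e j) := by
  have hpos : ∀ j, 0 < 1 + k / 2 * lam j := fun j => by have := he.pos j; positivity
  obtain ⟨y, hy⟩ := exists_multiplier e (m := fun j => (1 + k / 2 * lam j)⁻¹) (M := 1)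
    (fun j => by
      have := he.pos j
      rw [abs_of_pos (inv_pos.2 (hpos j))]
      exact inv_le_one_of_one_le₀ (by linarith [show 0 < k / 2 * lam j by positivity])) x
  -- The second entry is forced by `y + (k/2) A y = x`; that `y` lies in the domain is the
  -- maximality of the diagonal generator.
  have hf : (y, (2 / k) • (x - y)) ∈ A.graph := by
    refine hE.mem_graph_of_inner he.pos he.eigen fun j => ?_
    simp only [inner_smul_left, inner_sub_left, hy j, conj_trivial]
    have h1 := mul_inv_cancel₀ (hpos j).ne'
    have h2 : 2 / k * (k / 2) = 1 := by field_simp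
    linear_combination (-(2 / k) * inner ℝ x (e j)) * h1 +
      lam j * (1 + k / 2 * lam j)⁻¹ * inner ℝ x (e j) * h2
  have h1 := mem_graph_stepResolvent he hE hk (mem_graph_onePlus (k / 2) hf)
  have h2 : y + (k / 2) • ((2 / k) • (x - y)) = x := by
    rw [smul_smul, show k / 2 * (2 / k) = 1 by field_simp, one_smul, add_sub_cancel]
  rw [h2] at h1
  exact ⟨y, h1, hy⟩

theorem eigen_modifiedOp (he : IsEigenbasis A lam e) (hE : IsSemigroupGeneratedBy E (-A))
    (hk : 0 < k) (j : ℕ) :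
    (e j, modifiedEigenvalue k (lam j) • e j) ∈ (modifiedOp A k).graph := by
  have hpos : 0 < 1 + k / 2 * lam j := by have := he.pos j; positivity
  -- Graph membership is stated for all multiples of `e j`, so that the output of one factor is an
  -- admissible input of the next and the domain conditions of the product hold automatically.
  have hA : ∀ c : ℝ, (c • e j, (lam j * c) • e j) ∈ A.graph := fun c => by
    have := A.graph.smul_mem c (he.eigen j)
    rwa [Prod.smul_mk, smul_smul, mul_comm] at this
  have hM : ∀ b c : ℝ, (c • e j, ((1 + b * lam j) * c) • e j) ∈ (onePlus A b).graph :=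
    fun b c => by
      have := mem_graph_onePlus b (hA c)
      rwa [smul_smul, ← add_smul, show c + b * (lam j * c) = (1 + b * lam j) * c by ring] at this
  have hR : ∀ c : ℝ, (c • e j, ((1 + k / 2 * lam j)⁻¹ * c) • e j) ∈ (stepResolvent A k).graph :=
    fun c => by
      have := mem_graph_stepResolvent he hE hk (hM (k / 2) ((1 + k / 2 * lam j)⁻¹ * c))
      rwa [mul_inv_cancel_left₀ hpos.ne'] at this
  have := mem_graph_opMul (mem_graph_opMul (mem_graph_opMul (hR 1) (hR _)) (hM (k / 4) _)) (hA _)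
  rw [one_smul] at this
  convert! this using 3
  unfold modifiedEigenvalue
  ring

/-- The error estimates for an abstract operator with an eigenbasis. -/
theorem norm_semigroup_sub_modified_le (he : IsEigenbasis A lam e) (hk : 0 < k)
    (hE : IsSemigroupGeneratedBy E (-A)) (hEk : IsSemigroupGeneratedBy Ek (-modifiedOp A k))
    {s : ℝ} (hs0 : 0 ≤ s) (hs : s ≤ 2) {x : H} (hx : MemHdot lam e s x) {t : ℝ} (ht : 0 < t) :
    ‖E t x - Ek t x‖ ≤ 9 * k ^ (s / 2) * normHdot lam e s x := by
  refine norm_le_mul_normHdot he.pos (by positivity) hx fun j => ?_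
  rw [inner_sub_left, hE.inner_apply he.eigen ht.le,
    hEk.inner_apply (eigen_modifiedOp he hE hk) ht.le, ← sub_mul, abs_mul]
  gcongr
  exact abs_exp_sub_exp_modified_le_rpow hk (he.pos j) ht hs0 hs

theorem norm_semigroup_sub_smoothed_le (he : IsEigenbasis A lam e) (hk : 0 < k)
    (hE : IsSemigroupGeneratedBy E (-A)) (hEk : IsSemigroupGeneratedBy Ek (-modifiedOp A k))
    {r s : ℝ} (hr : 0 ≤ r) (hrs : r ≤ s) (hs : s ≤ 2) {x : H} (hx : MemHdot lam e (s - r) x) :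
    ∃ hx : x ∈ (stepResolvent A k).domain, ∀ t : ℝ, 0 < t →
      ‖E t x - Ek t (stepResolvent A k ⟨x, hx⟩)‖ ≤
        9 * k ^ (s / 2) * t ^ (-(r / 2)) * normHdot lam e (s - r) x := by
  obtain ⟨y, hxy, hy⟩ := exists_stepResolvent he hE hk x
  obtain ⟨u, rfl, rfl⟩ := (LinearPMap.mem_graph_iff _).1 hxy
  refine ⟨u.2, fun t ht => norm_le_mul_normHdot he.pos (by positivity) hx fun j => ?_⟩
  rw [inner_sub_left, hE.inner_apply he.eigen ht.le,
    hEk.inner_apply (eigen_modifiedOp he hE hk) ht.le, hy j, ← mul_assoc, ← sub_mul, abs_mul]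
  gcongr
  exact abs_exp_sub_smoothed_le_rpow hk (he.pos j) ht hr hrs hs

end Main

end Abstract

end EllipticSemigroup

theorem mainTheorem6 :
    ∃ C : ℝ, 0 < C ∧
      ∀ (d : ℕ) (P : EllipticSemigroup.DirichletData d)
        (lam : ℕ → ℝ) (e : HilbertBasis ℕ ℝ (EllipticSemigroup.L2 P.D)),
        EllipticSemigroup.IsEigenbasis P.op lam e →
      ∀ k : ℝ, 0 < k →
      ∀ E Ek : ℝ → EllipticSemigroup.L2 P.D →L[ℝ] EllipticSemigroup.L2 P.D,
        EllipticSemigroup.IsSemigroupGeneratedBy E (-P.op) →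
        EllipticSemigroup.IsSemigroupGeneratedBy Ek (-EllipticSemigroup.modifiedOp P.op k) →
      ∀ r s : ℝ, 0 ≤ r → r ≤ s → s ≤ 2 →
        (∀ x : EllipticSemigroup.L2 P.D, EllipticSemigroup.MemHdot lam e (s - r) x →
          ∃ hx : x ∈ (EllipticSemigroup.stepResolvent P.op k).domain, ∀ t : ℝ, 0 < t →
            ‖E t x - Ek t (EllipticSemigroup.stepResolvent P.op k ⟨x, hx⟩)‖ ≤
              C * k ^ (s / 2) * t ^ (-(r / 2)) *
                EllipticSemigroup.normHdot lam e (s - r) x) ∧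
        (∀ x : EllipticSemigroup.L2 P.D, EllipticSemigroup.MemHdot lam e s x →
          ∀ t : ℝ, 0 < t →
            ‖E t x - Ek t x‖ ≤
              C * k ^ (s / 2) * EllipticSemigroup.normHdot lam e s x) := by
  refine ⟨9, by norm_num, fun d P lam e he k hk E Ek hE hEk r s hr hrs hs => ⟨fun x hx => ?_,
    fun x hx t ht => ?_⟩⟩
  · exact EllipticSemigroup.norm_semigroup_sub_smoothed_le he hk hE hEk hr hrs hs hx
  · exact EllipticSemigroup.norm_semigroup_sub_modified_le he hk hE hEk (hr.trans hrs) hs hx ht
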